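/- Consider $N$-player normal-form games in which every player $i$ has $A$ actions $\mathcal A_i$ and a utility function $u_i:\mathcal A_1\times\cdots\times\mathcal A_N\to[0,1]$. Under bandit feedback, playing a profile $a$ once (one *sample*) reveals a payoff vector $(U_1,\dots,U_N)\in[0,1]^N$, drawn, given $a$, independently of the past from a law that belongs to the game and satisfies $\mathbb E[U_i\mid a]=u_i(a)$. For $\Delta>0$ let $E_0=\emptyset$ and let $E_{l}$ be the set of actions $a\in\mathcal A_i$ ($1\le i\le N$) for which there is a mixed strategy $x$ of player $i$ with $u_i(a,a_{-i})\le u_i(x,a_{-i})-\Delta$ for all $a_{-i}$ that use no action of $E_{l-1}$. An action is *$\Delta$-rationalizable* if it is not in $E_L$, where $L=\inf\{l:E_{l+1}=E_l\}$. An action is *rationalizable* (or $0$-rationalizable) if it survives the same elimination procedure with the condition replaced by strict dominance, $u_i(a,a_{-i})<u_i(x,a_{-i})$. An algorithm chooses adaptively, with randomization, after each sample either the next profile to play or to stop and answer yes or no. It *decides on a class $\mathcal G$ of games whether action $a$ of player $i$ is rationalizable up to tolerance $\Delta$ with probability $0.9$* if, on every game of $\mathcal G$, it answers yes with probability at least $0.9$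 when $a$ is rationalizable, and answers no with probability at least $0.9$ when $a$ is not $\Delta$-rationalizable (there is no requirement otherwise). **Proposition.** There is a universal constant $c>0$ such that for all $N\ge1$, $A\ge2$ and $0<\Delta<0.1$ there is a class $\mathcal G$ of $N$-player games with $A$ actions per player with the following property. For every player $i$ and every action $a$ of $i$ there is a game $G_0\in\mathcal G$ such that every algorithm that decides on $\mathcal G$ whether $a$ is rationalizable up to tolerance $\Delta$ with probability $0.9$ uses, on $G_0$, at least $c\,A^{N-1}\Delta^{-2}$ samples in expectation. -/

import Mathlib

open MeasureTheory ProbabilityTheory Finset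
open scoped ENNReal

namespace BanditGames

/-- Pure action profiles of an `N`-player game in which every player has the `A` actions
`0, …, A - 1`. -/
abbrev Profile (N A : ℕ) : Type := Fin N → Fin A

/-- An `N`-player normal-form game with `A` actions per player and utilities in `[0,1]`. -/
structure NormalFormGame (N A : ℕ) where
  utility : Fin N → Profile N A → ℝ
  utility_mem : ∀ i p, utility i p ∈ Set.Icc (0 : ℝ) 1

namespace NormalFormGame

variable {N A : ℕ} (G : NormalFormGame N A)

/-- Player `i`'s expected utility when she plays the mixed strategy `x` and the others play their
part of `b` (the entry `b i` is ignored). -/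
noncomputable def mixedUtility (i : Fin N) (x : Fin A → ℝ) (b : Profile N A) : ℝ :=
  ∑ a', x a' * G.utility i (Function.update b i a')

/-- The actions (tagged by their player) that are `Δ`-dominated by some mixed strategy, against all
opponent profiles that avoid the already eliminated actions `E`. -/
def dominated (Δ : ℝ) (E : Set (Fin N × Fin A)) : Set (Fin N × Fin A) :=
  {ia | ∃ x ∈ stdSimplex ℝ (Fin A), ∀ b : Profile N A, (∀ j, j ≠ ia.1 → (j, b j) ∉ E) →
    G.utility ia.1 (Function.update b ia.1 ia.2) ≤ G.mixedUtility ia.1 x b - Δ}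

/-- The actions that are strictly dominated by some mixed strategy, against all opponent profiles
that avoid the already eliminated actions `E`. -/
def strictlyDominated (E : Set (Fin N × Fin A)) : Set (Fin N × Fin A) :=
  {ia | ∃ x ∈ stdSimplex ℝ (Fin A), ∀ b : Profile N A, (∀ j, j ≠ ia.1 → (j, b j) ∉ E) →
    G.utility ia.1 (Function.update b ia.1 ia.2) < G.mixedUtility ia.1 x b}

/-- `E_l`: the set of actions eliminated by round `l`, starting from `E_0 = ∅`, when `D E` is the
set of actions dominated once the actions in `E` have been removed. -/
def eliminatedBy {α : Type*} (D : Set α → Set α) : ℕ → Set α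
  | 0 => ∅
  | l + 1 => D (eliminatedBy D l)

/-- The minimum elimination length `L = inf {l : E_{l+1} = E_l}`. -/
noncomputable def eliminationLength {α : Type*} (D : Set α → Set α) : ℕ :=
  sInf {l | eliminatedBy D (l + 1) = eliminatedBy D l}

/-- The action `a` of player `i` is `Δ`-rationalizable (used for `Δ > 0`): it is not in `E_L` for
iterated elimination of `Δ`-dominated actions. -/
def DeltaRationalizable (Δ : ℝ) (i : Fin N) (a : Fin A) : Prop :=
  (i, a) ∉ eliminatedBy (G.dominated Δ) (eliminationLength (G.dominated Δ))

/-- The action `a` of player `i` is rationalizable (the case of tolerance `0`): it survives the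
iterated elimination of strictly dominated actions. -/
def Rationalizable (i : Fin N) (a : Fin A) : Prop :=
  (i, a) ∉ eliminatedBy G.strictlyDominated (eliminationLength G.strictlyDominated)

end NormalFormGame

/-- The random payoffs of all the players in one round. -/
abbrev Feedback (N : ℕ) : Type := Fin N → unitInterval

/-- A game with bandit feedback: when the profile `p` is played, the players observe a random
payoff vector in `[0,1]^N` of law `feedback p`, whose mean is the vector of utilities at `p`. -/
structure BanditGame (N A : ℕ) extends NormalFormGame N A where
  feedback : Profile N A → Measure (Feedback N)
  isProbabilityMeasure_feedback : ∀ p, IsProbabilityMeasure (feedback p)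
  integral_feedback : ∀ i p, ∫ U, (U i : ℝ) ∂(feedback p) = utility i p

/-- What an algorithm can do next: play a profile, or stop with the answer yes (`true`) or
no (`false`). -/
abbrev Move (N A : ℕ) : Type := Profile N A ⊕ Bool

/-- What is recorded in one time step: a sample (the profile played and the feedback observed), or
the answer with which the algorithm has stopped. -/
abbrev Record (N A : ℕ) : Type := (Profile N A × Feedback N) ⊕ Bool

/-- The records of the time steps `0, …, n`. -/
abbrev History (N A n : ℕ) : Type := (_k : Finset.Iic n) → Record N A

/-- An adaptive randomized algorithm: the law of the first move, and the conditional law of the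
next move given everything observed so far. (Once the algorithm has stopped, `next` is no longer
consulted.) -/
structure Algorithm (N A : ℕ) where
  first : Measure (Move N A)
  isProbabilityMeasure_first : IsProbabilityMeasure first
  next : (n : ℕ) → Kernel (History N A n) (Move N A)
  isMarkovKernel_next : ∀ n, IsMarkovKernel (next n)

instance (N A : ℕ) : MeasurableSingletonClass (Move N A) := by
  refine ⟨fun m => ?_⟩
  rcases m with p | d
  · rw [← Set.image_singleton]
    exact (measurableSet_singleton p).inl_image
  · rw [← Set.image_singleton]
    exact (measurableSet_singleton d).inr_image

namespace BanditGame

variable {N A : ℕ} (G : BanditGame N A)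

/-- The record produced by a move: playing `p` yields a fresh feedback of law `G.feedback p`. -/
noncomputable def respond : Kernel (Move N A) (Record N A) :=
  Kernel.ofFunOfCountable fun m => match m with
    | Sum.inl p => (G.feedback p).map fun U => Sum.inl (p, U)
    | Sum.inr d => Measure.dirac (Sum.inr d)

instance : IsMarkovKernel G.respond := by
  refine ⟨fun m => ?_⟩
  rcases m with p | d
  · have := G.isProbabilityMeasure_feedback p
    change IsProbabilityMeasure ((G.feedback p).map fun U => (Sum.inl (p, U) : Record N A))
    exact Measure.isProbabilityMeasure_map (by fun_prop)
  · change IsProbabilityMeasure (Measure.dirac (Sum.inr d : Record N A))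
    infer_instance

end BanditGame

namespace Algorithm

variable {N A : ℕ} (alg : Algorithm N A) (G : BanditGame N A)

/-- The histories of length `n + 1` in which the algorithm has stopped. -/
def stoppedAt (N A n : ℕ) : Set (History N A n) :=
  {h | (h ⟨n, Finset.mem_Iic.2 le_rfl⟩).isRight = true}

theorem measurableSet_stoppedAt (N A n : ℕ) : MeasurableSet (stoppedAt N A n) := by
  have h : MeasurableSet {r : Record N A | r.isRight = true} := by
    have : {r : Record N A | r.isRight = true} = Set.range Sum.inr := by
      ext r
      cases r <;> simp
    rw [this]
    exact measurableSet_range_inr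
  exact (measurable_pi_apply (X := fun _ : Finset.Iic n => Record N A) _) h

open Classical in
/-- The conditional law of the next record given the history: an algorithm that has stopped keeps
its answer; otherwise it makes its next move and `G` responds. -/
noncomputable def step (n : ℕ) : Kernel (History N A n) (Record N A) :=
  Kernel.piecewise (measurableSet_stoppedAt N A n)
    (Kernel.deterministic (fun h => h ⟨n, Finset.mem_Iic.2 le_rfl⟩) (measurable_pi_apply _))
    (G.respond ∘ₖ alg.next n)

instance (n : ℕ) : IsMarkovKernel (alg.step G n) := by
  have := alg.isMarkovKernel_next n
  unfold step
  infer_instance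

/-- The law of the infinite sequence of records when `alg` is run on `G`. -/
noncomputable def law : Measure (ℕ → Record N A) :=
  Kernel.trajMeasure (X := fun _ => Record N A) (alg.first.bind G.respond) (alg.step G)

instance : IsProbabilityMeasure (alg.law G) := by
  have := alg.isProbabilityMeasure_first
  unfold law
  infer_instance

/-- The event that the algorithm stops with answer `d`. -/
def answers (N A : ℕ) (d : Bool) : Set (ℕ → Record N A) :=
  {τ | ∃ n, τ n = Sum.inr d}

/-- The total number of samples along a sequence of records (possibly infinite). -/
noncomputable def numSamples (τ : ℕ → Record N A) : ℝ≥0∞ :=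
  ∑' n, if (τ n).isLeft then 1 else 0

/-- The expected number of samples used when `alg` is run on `G`. -/
noncomputable def expectedSamples : ℝ≥0∞ :=
  ∫⁻ τ, numSamples τ ∂(alg.law G)

/-- On every game of the class `𝒢`, `alg` decides with probability at least `q` whether action `a`
of player `i` is rationalizable up to tolerance `Δ`: it answers yes if the action is rationalizable
and no if the action is not `Δ`-rationalizable (and anything otherwise). -/
def Decides (𝒢 : Set (BanditGame N A)) (i : Fin N) (a : Fin A) (Δ q : ℝ) : Prop :=
  ∀ G ∈ 𝒢,
    (G.Rationalizable i a → q ≤ (alg.law G).real (answers N A true)) ∧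
    (¬ G.DeltaRationalizable Δ i a → q ≤ (alg.law G).real (answers N A false))

end Algorithm

end BanditGames

namespace BanditGames

/-! ### Integrals along a run of the algorithm -/

namespace BanditGame

variable {N A : ℕ} (G : BanditGame N A)

/-! Fix a player `i` and an action `a' ≠ a`, and let `S` be the set of profiles in which `i` plays
`a'`. In `hardGame hΔ i S`, player `i` earns mean `1/2 + Δ` on `S` and `1/2` elsewhere, so `a'`
beats `a` by `Δ` everywhere and the answer must be no. Lowering the mean to `1/2` at one profile `p
∈ S` leaves a profile where no deviation changes the deviator's payoff; nothing is ever eliminated,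
and the answer must be yes.

A correct algorithm thus separates the original game from each of the `A ^ (N - 1)` modified games.
Each of these differs from it only at its own `p`, and by `Δ` only, so order `Δ⁻²` expected samples
of `p` are needed, all counted under the original game. A sample concerns one profile, so these
costs add up.

The bound for one `p` is a change of measure (`lintegral_law_eq_lintegral_mul_prod`) followed by an
elementary pointwise inequality on the likelihood ratio (`law_real_le_of_score`), which replaces an
information inequality. -/

theorem lintegral_respond_inl (p : Profile N A) {f : Record N A → ℝ≥0∞} (hf : Measurable f) :
    ∫⁻ x, f x ∂(G.respond (Sum.inl p)) = ∫⁻ U, f (Sum.inl (p, U)) ∂(G.feedback p) := by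
  change ∫⁻ x, f x ∂((G.feedback p).map fun U => (Sum.inl (p, U) : Record N A)) = _
  rw [lintegral_map hf (by fun_prop)]

theorem lintegral_respond_inr (d : Bool) {f : Record N A → ℝ≥0∞} (hf : Measurable f) :
    ∫⁻ x, f x ∂(G.respond (Sum.inr d)) = f (Sum.inr d) := by
  change ∫⁻ x, f x ∂(Measure.dirac (Sum.inr d : Record N A)) = _
  rw [lintegral_dirac' _ hf]

end BanditGame

namespace Algorithm

variable {N A : ℕ} (alg : Algorithm N A) (G G' : BanditGame N A)

open Classical in
theorem lintegral_step_of_mem {n : ℕ} {h : History N A n} (hh : h ∈ stoppedAt N A n)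
    {f : Record N A → ℝ≥0∞} (hf : Measurable f) :
    ∫⁻ x, f x ∂(alg.step G n h) = f (h ⟨n, Finset.mem_Iic.2 le_rfl⟩) := by
  rw [step, Kernel.piecewise_apply, if_pos hh, Kernel.deterministic_apply, lintegral_dirac' _ hf]

open Classical in
theorem lintegral_step_of_notMem {n : ℕ} {h : History N A n} (hh : h ∉ stoppedAt N A n)
    {f : Record N A → ℝ≥0∞} (hf : Measurable f) :
    ∫⁻ x, f x ∂(alg.step G n h) = ∫⁻ m, ∫⁻ x, f x ∂(G.respond m) ∂(alg.next n h) := by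
  rw [step, Kernel.piecewise_apply, if_neg hh, Kernel.lintegral_comp _ _ _ hf]

theorem lintegral_law_zero {f : Record N A → ℝ≥0∞} (hf : Measurable f) :
    ∫⁻ τ, f (τ 0) ∂(alg.law G) = ∫⁻ m, ∫⁻ x, f x ∂(G.respond m) ∂alg.first := by
  have := alg.isProbabilityMeasure_first
  have h0 : (alg.law G).map (Preorder.frestrictLe (π := fun _ : ℕ => Record N A) 0) =
      (alg.first.bind G.respond).map
        (MeasurableEquiv.piUnique (fun _ : Finset.Iic 0 => Record N A)).symm := by
    rw [law, Kernel.trajMeasure, Measure.map_comp _ _ (by fun_prop), Kernel.traj_map_frestrictLe,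
      Kernel.partialTraj_self, Measure.id_comp]
  have h1 : ∫⁻ τ, f (τ 0) ∂(alg.law G) = ∫⁻ h : History N A 0, f (h ⟨0, Finset.mem_Iic.2 le_rfl⟩)
      ∂((alg.law G).map (Preorder.frestrictLe (π := fun _ : ℕ => Record N A) 0)) := by
    rw [lintegral_map (by fun_prop) (by fun_prop)]
    rfl
  rw [h1, h0, lintegral_map (by fun_prop) (by fun_prop),
    ← Measure.lintegral_bind (by fun_prop) (by fun_prop)]
  rfl

theorem lintegral_law_succ (n : ℕ) {f : History N A n × Record N A → ℝ≥0∞} (hf : Measurable f) :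
    ∫⁻ τ, f (Preorder.frestrictLe n τ, τ (n + 1)) ∂(alg.law G) =
      ∫⁻ τ, ∫⁻ x, f (Preorder.frestrictLe n τ, x) ∂(alg.step G n (Preorder.frestrictLe n τ))
        ∂(alg.law G) := by
  have := alg.isProbabilityMeasure_first
  have key := Kernel.map_frestrictLe_trajMeasure_compProd_eq_map_trajMeasure
    (X := fun _ => Record N A) (μ₀ := alg.first.bind G.respond) (κ := alg.step G) (a := n)
  change (alg.law G).map _ ⊗ₘ _ = (alg.law G).map _ at key
  rw [← lintegral_map (f := f) hf (by fun_prop), ← key, Measure.lintegral_compProd hf,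
    lintegral_map (hf.lintegral_kernel_prod_right') (by fun_prop)]

/-- A repeated answer is also the response to the move `Sum.inr d`, so a bound valid for every move
covers stopped histories as well. -/
theorem lintegral_law_eval_le {f : Record N A → ℝ≥0∞} (hf : Measurable f) {C : ℝ≥0∞}
    (h : ∀ m, ∫⁻ x, f x ∂(G.respond m) ≤ C) (n : ℕ) :
    ∫⁻ τ, f (τ n) ∂(alg.law G) ≤ C := by
  have := alg.isProbabilityMeasure_first
  cases n with
  | zero =>
    rw [lintegral_law_zero _ _ hf]
    exact (lintegral_mono h).trans (by simp)
  | succ n =>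
    have := alg.isMarkovKernel_next n
    rw [lintegral_law_succ alg G n (f := fun y => f y.2) (by fun_prop)]
    refine (lintegral_mono (g := fun _ => C) fun τ => ?_).trans (by simp)
    by_cases hh : Preorder.frestrictLe n τ ∈ stoppedAt N A n
    · rw [lintegral_step_of_mem _ _ hh hf]
      obtain ⟨d, hd⟩ := Sum.isRight_iff.1 hh
      rw [hd, ← G.lintegral_respond_inr d hf]
      exact h _
    · rw [lintegral_step_of_notMem _ _ hh hf]
      exact (lintegral_mono h).trans (by simp)

/-! ### Change of measure between two games -/

/-- The trajectory that follows `h` up to time `n` and is constantly `x` afterwards. -/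
def extend {n : ℕ} (y : History N A n × Record N A) : ℕ → Record N A :=
  fun k => if hk : k ≤ n then y.1 ⟨k, Finset.mem_Iic.2 hk⟩ else y.2

theorem measurable_extend (n : ℕ) : Measurable (extend (N := N) (A := A) (n := n)) := by
  refine measurable_pi_lambda _ fun k => ?_
  by_cases hk : k ≤ n
  · simp only [extend, hk, dite_true]
    fun_prop
  · simp only [extend, hk, dite_false]
    fun_prop

theorem extend_apply_of_le {n k : ℕ} (hk : k ≤ n) (τ : ℕ → Record N A) (x : Record N A) :
    extend (Preorder.frestrictLe n τ, x) k = τ k := by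
  simp [extend, hk]

theorem extend_apply_succ {n : ℕ} (h : History N A n) (x : Record N A) :
    extend (h, x) (n + 1) = x := by
  simp [extend]

theorem lintegral_respond_eq_mul {r : Record N A → ℝ≥0∞} (hr : Measurable r)
    (hrd : ∀ d, r (Sum.inr d) = 1)
    (h : ∀ (p : Profile N A) (f : Feedback N → ℝ≥0∞), Measurable f →
      ∫⁻ U, f U ∂(G'.feedback p) = ∫⁻ U, f U * r (Sum.inl (p, U)) ∂(G.feedback p))
    {f : Record N A → ℝ≥0∞} (hf : Measurable f) (m : Move N A) :
    ∫⁻ x, f x ∂(G'.respond m) = ∫⁻ x, f x * r x ∂(G.respond m) := by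
  rcases m with p | d
  · rw [G'.lintegral_respond_inl p hf,
      G.lintegral_respond_inl p (f := fun x => f x * r x) (by fun_prop), h p _ (by fun_prop)]
  · rw [G'.lintegral_respond_inr d hf,
      G.lintegral_respond_inr d (f := fun x => f x * r x) (by fun_prop), hrd, mul_one]

/-- Change of measure: if the feedback of `G'` has density `r` with respect to that of `G`, then
the law of the first records on `G'` has the product of the `r`'s as density. -/
theorem lintegral_law_eq_lintegral_mul_prod {r : Record N A → ℝ≥0∞} (hr : Measurable r)
    (hrd : ∀ d, r (Sum.inr d) = 1)
    (h : ∀ (p : Profile N A) (f : Feedback N → ℝ≥0∞), Measurable f →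
      ∫⁻ U, f U ∂(G'.feedback p) = ∫⁻ U, f U * r (Sum.inl (p, U)) ∂(G.feedback p))
    (n : ℕ) {F : (ℕ → Record N A) → ℝ≥0∞} (hF : Measurable F) (hdep : DependsOn F (Set.Iic n)) :
    ∫⁻ τ, F τ ∂(alg.law G') = ∫⁻ τ, F τ * ∏ k ∈ range (n + 1), r (τ k) ∂(alg.law G) := by
  have hresp := fun {f : Record N A → ℝ≥0∞} (hf : Measurable f) m =>
    lintegral_respond_eq_mul G G' hr hrd h hf m
  induction n generalizing F with
  | zero =>
    have hF0 : ∀ τ, F τ = F (fun _ => τ 0) := fun τ => hdep fun k hk => by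
      have : k = 0 := Nat.le_zero.1 hk
      rw [this]
    have hm : Measurable fun x : Record N A => F fun _ => x :=
      hF.comp (measurable_pi_lambda _ fun _ => measurable_id)
    have e1 : ∫⁻ τ, F τ ∂(alg.law G') = ∫⁻ τ, (fun x => F fun _ => x) (τ 0) ∂(alg.law G') :=
      lintegral_congr hF0
    have e2 : ∫⁻ τ, F τ * ∏ k ∈ range (0 + 1), r (τ k) ∂(alg.law G) =
        ∫⁻ τ, (fun x => (F fun _ => x) * r x) (τ 0) ∂(alg.law G) := by
      refine lintegral_congr fun τ => ?_
      rw [hF0 τ]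
      simp
    rw [e1, e2, lintegral_law_zero alg G' hm,
      lintegral_law_zero alg G (f := fun x => (F fun _ => x) * r x) (by fun_prop)]
    exact lintegral_congr fun m => hresp hm m
  | succ n ih =>
    have hstep : ∀ (hh : History N A n) {f : Record N A → ℝ≥0∞}, Measurable f →
        ∫⁻ x, f x ∂(alg.step G' n hh) = ∫⁻ x, f x * r x ∂(alg.step G n hh) := by
      intro hh f hf
      by_cases hs : hh ∈ stoppedAt N A n
      · rw [lintegral_step_of_mem _ _ hs hf,
          lintegral_step_of_mem _ _ hs (f := fun x => f x * r x) (by fun_prop)]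
        obtain ⟨d, hd⟩ := Sum.isRight_iff.1 hs
        rw [hd, hrd, mul_one]
      · rw [lintegral_step_of_notMem _ _ hs hf,
          lintegral_step_of_notMem _ _ hs (f := fun x => f x * r x) (by fun_prop)]
        exact lintegral_congr fun m => hresp hf m
    have hext : ∀ τ : ℕ → Record N A, ∀ k ≤ n + 1,
        extend (Preorder.frestrictLe n τ, τ (n + 1)) k = τ k := by
      intro τ k hk
      rcases Nat.le_succ_iff.1 hk with hk | rfl
      · exact extend_apply_of_le hk _ _
      · exact extend_apply_succ _ _
    have hFe : Measurable fun y : History N A n × Record N A => F (extend y) :=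
      hF.comp (measurable_extend n)
    have hg : Measurable fun y : History N A n × Record N A =>
        F (extend y) * ∏ k ∈ range (n + 1 + 1), r (extend y k) := by
      refine hFe.mul (Finset.measurable_fun_prod _ fun k _ => ?_)
      exact hr.comp ((measurable_pi_apply k).comp (measurable_extend n))
    have e1 : ∫⁻ τ, F τ ∂(alg.law G') =
        ∫⁻ τ, F (extend (Preorder.frestrictLe n τ, τ (n + 1))) ∂(alg.law G') :=
      lintegral_congr fun τ => hdep fun k hk => (hext τ k hk).symm
    have e2 : ∫⁻ τ, F τ * ∏ k ∈ range (n + 1 + 1), r (τ k) ∂(alg.law G) =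
        ∫⁻ τ, (fun y => F (extend y) * ∏ k ∈ range (n + 1 + 1), r (extend y k))
          (Preorder.frestrictLe n τ, τ (n + 1)) ∂(alg.law G) := by
      refine lintegral_congr fun τ => ?_
      congr 1
      · exact hdep fun k hk => (hext τ k hk).symm
      · refine Finset.prod_congr rfl fun k hk => ?_
        rw [hext τ k (Nat.lt_succ_iff.1 (Finset.mem_range.1 hk))]
    -- Integrating out the last record leaves a functional of the records up to `n`, to which the
    -- induction hypothesis applies.
    rw [e1, e2, lintegral_law_succ alg G' n hFe, lintegral_law_succ alg G n hg, ih]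
    · refine lintegral_congr fun τ => ?_
      have hm : Measurable fun x => F (extend (Preorder.frestrictLe n τ, x)) :=
        hFe.comp measurable_prodMk_left
      rw [hstep _ hm, ← lintegral_mul_const]
      · refine lintegral_congr fun x => ?_
        rw [prod_range_succ _ (n + 1), extend_apply_succ, mul_assoc, mul_comm (r x)]
        congr 2
        refine Finset.prod_congr rfl fun k hk => ?_
        rw [extend_apply_of_le (Nat.lt_succ_iff.1 (Finset.mem_range.1 hk))]
      · exact hm.mul hr
    · exact (hFe.lintegral_kernel_prod_right' (κ := alg.step G' n)).comp (by fun_prop)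
    · intro τ τ' hττ
      have : (Preorder.frestrictLe n τ : History N A n) = Preorder.frestrictLe n τ' :=
        funext fun k => hττ k (Finset.mem_Iic.1 k.2)
      simp only [this]

/-! ### An answer is final -/

theorem ae_law_succ_eq (d : Bool) (n : ℕ) :
    ∀ᵐ τ ∂(alg.law G), τ n = Sum.inr d → τ (n + 1) = Sum.inr d := by
  have hd : MeasurableSet ({Sum.inr d} : Set (Record N A)) := by
    rw [← Set.image_singleton]
    exact (measurableSet_singleton d).inr_image
  let f : History N A n × Record N A → ℝ≥0∞ := fun y =>
    ({Sum.inr d} : Set (Record N A)).indicator 1 (y.1 ⟨n, Finset.mem_Iic.2 le_rfl⟩) *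
      ({Sum.inr d} : Set (Record N A))ᶜ.indicator 1 y.2
  have h1 : Measurable (({Sum.inr d} : Set (Record N A)).indicator (1 : Record N A → ℝ≥0∞)) :=
    measurable_one.indicator hd
  have h2 : Measurable (({Sum.inr d} : Set (Record N A))ᶜ.indicator (1 : Record N A → ℝ≥0∞)) :=
    measurable_one.indicator hd.compl
  have hf : Measurable f := by fun_prop
  have h0 : ∫⁻ τ, f (Preorder.frestrictLe n τ, τ (n + 1)) ∂(alg.law G) = 0 := by
    rw [lintegral_law_succ alg G n hf]
    refine lintegral_eq_zero_of_ae_eq_zero (Filter.Eventually.of_forall fun τ => ?_)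
    by_cases hτ : τ n = Sum.inr d
    · have hs : Preorder.frestrictLe n τ ∈ stoppedAt N A n := by
        simp [stoppedAt, hτ]
      dsimp only
      rw [lintegral_step_of_mem _ _ hs (f := fun x => f (Preorder.frestrictLe n τ, x)) (by fun_prop)]
      simp [f, hτ]
    · simp [f, hτ]
  rw [lintegral_eq_zero_iff (by fun_prop)] at h0
  filter_upwards [h0] with τ hτ hn
  by_contra hne
  simp [f, hn, hne] at hτ

theorem ae_law_eq_of_le (d : Bool) :
    ∀ᵐ τ ∂(alg.law G), ∀ n m, n ≤ m → τ n = Sum.inr d → τ m = Sum.inr d := by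
  filter_upwards [ae_all_iff.2 (alg.ae_law_succ_eq G d)] with τ hτ n m hnm hn
  induction m, hnm using Nat.le_induction with
  | base => exact hn
  | succ m _ ih => exact hτ m ih

theorem measurableSet_eq_inr (d : Bool) (n : ℕ) :
    MeasurableSet {τ : ℕ → Record N A | τ n = Sum.inr d} := by
  have hd : MeasurableSet ({Sum.inr d} : Set (Record N A)) := by
    rw [← Set.image_singleton]
    exact (measurableSet_singleton d).inr_image
  exact measurable_pi_apply (X := fun _ : ℕ => Record N A) n hd

theorem measurableSet_answers (d : Bool) : MeasurableSet (answers N A d) := by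
  have : answers N A d = ⋃ n, {τ | τ n = Sum.inr d} := by
    ext τ
    simp [answers]
  rw [this]
  exact MeasurableSet.iUnion fun n => measurableSet_eq_inr d n

/-- Answers persist almost surely, so both cannot occur in one run: at the later of the two times
the record would equal both. -/
theorem law_real_answers_add_le (G : BanditGame N A) :
    (alg.law G).real (answers N A true) + (alg.law G).real (answers N A false) ≤ 1 := by
  have hd : AEDisjoint (alg.law G) (answers N A true) (answers N A false) := by
    have : ∀ᵐ τ ∂(alg.law G), τ ∉ answers N A true ∩ answers N A false := by
      filter_upwards [alg.ae_law_eq_of_le G true, alg.ae_law_eq_of_le G false] with τ ht hf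
      rintro ⟨⟨n, hn⟩, m, hm⟩
      rcases le_total n m with h | h
      · simp [ht n m h hn] at hm
      · simp [hf m n h hm] at hn
    simpa [AEDisjoint, ae_iff] using this
  rw [← measureReal_union₀ (measurableSet_answers false).nullMeasurableSet hd]
  exact measureReal_le_one

end Algorithm

/-! ### The likelihood-ratio score -/

/-- The score of a record: it is nonzero only on the samples of the profile `p`, where it depends
affinely on the payoff of player `i`, with values in `[-2Δ, 2Δ]`. -/
noncomputable def score {N A : ℕ} (Δ : ℝ) (i : Fin N) (p : Profile N A) : Record N A → ℝ :=
  Sum.elim (fun y => if y.1 = p then 2 * Δ * (2 * (y.2 i : ℝ) - 1) else 0) fun _ => 0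

/-- The records that are samples of the profile `p`. -/
def samplesOf {N A : ℕ} (p : Profile N A) : Set (Record N A) :=
  Sum.inl '' {y | y.1 = p}

section score

variable {N A : ℕ} {Δ : ℝ} (i : Fin N) (p : Profile N A)

theorem measurableSet_samplesOf : MeasurableSet (samplesOf p) :=
  (measurableSet_eq_fun measurable_fst measurable_const).inl_image

theorem inl_mem_samplesOf {q : Profile N A} {U : Feedback N} :
    (Sum.inl (q, U) : Record N A) ∈ samplesOf p ↔ q = p := by
  simp [samplesOf]

theorem measurable_score : Measurable (score Δ i p) := by
  refine Measurable.sumElim ?_ measurable_const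
  refine Measurable.ite (measurableSet_eq_fun measurable_fst measurable_const) ?_ measurable_const
  fun_prop

theorem abs_score_le (hΔ : 0 ≤ Δ) (x : Record N A) : |score Δ i p x| ≤ 2 * Δ := by
  rcases x with ⟨q, U⟩ | d
  · simp only [score, Sum.elim_inl]
    split_ifs
    · have h0 := (U i).2.1
      have h1 := (U i).2.2
      rw [abs_le]
      constructor <;> nlinarith
    · simpa using hΔ
  · simpa [score] using hΔ

end score

/-! ### Samples needed to tell two games apart -/

namespace Algorithm

variable {N A : ℕ} (alg : Algorithm N A) (G G' : BanditGame N A)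

/-- Adding the bound `C` makes `g` nonnegative, which reduces the claim to `lintegral_law_eval_le`.
-/
theorem integral_law_eval_nonpos {g : Record N A → ℝ} (hg : Measurable g) {C : ℝ}
    (hC : ∀ x, |g x| ≤ C)
    (h : ∀ p, ∫ U, g (Sum.inl (p, U)) ∂(G.feedback p) ≤ 0) (hd : ∀ d, g (Sum.inr d) ≤ 0) (n : ℕ) :
    ∫ τ, g (τ n) ∂(alg.law G) ≤ 0 := by
  have hint : ∀ {α : Type} [MeasurableSpace α] (μ : Measure α) [IsProbabilityMeasure μ]
      (φ : α → Record N A), Measurable φ → Integrable (fun y => g (φ y)) μ := fun μ _ φ hφ =>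
    .of_bound (hg.comp hφ).aestronglyMeasurable C (.of_forall fun y => hC _)
  have hpos : ∀ x, 0 ≤ g x + C := fun x => by linarith [neg_abs_le (g x), hC x]
  have hC0 : 0 ≤ C := (abs_nonneg _).trans (hC (Sum.inr true))
  have key := alg.lintegral_law_eval_le G (f := fun x => ENNReal.ofReal (g x + C))
    (by fun_prop) (C := ENNReal.ofReal C) (fun m => ?_) n
  · have hi := hint (alg.law G) (fun τ => τ n) (by fun_prop)
    have hiC : Integrable (fun τ => g (τ n) + C) (alg.law G) := hi.add (integrable_const C)
    rw [← ofReal_integral_eq_lintegral_ofReal hiC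
      (.of_forall fun τ => hpos _), ENNReal.ofReal_le_ofReal_iff hC0,
      integral_add hi (integrable_const C)] at key
    simpa using key
  · rcases m with p | d
    · have := G.isProbabilityMeasure_feedback p
      have hi := hint (G.feedback p) (fun U => Sum.inl (p, U)) (by fun_prop)
      have hiC : Integrable (fun U => g (Sum.inl (p, U)) + C) (G.feedback p) :=
        hi.add (integrable_const C)
      rw [G.lintegral_respond_inl p (by fun_prop), ← ofReal_integral_eq_lintegral_ofReal hiC
        (.of_forall fun τ => hpos _), ENNReal.ofReal_le_ofReal_iff hC0,
        integral_add hi (integrable_const C)]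
      simpa using h p
    · rw [G.lintegral_respond_inr d (by fun_prop)]
      exact ENNReal.ofReal_le_ofReal (by linarith [hd d])

/-- A sample of `p` has mean score `2Δ(2(1/2 + Δ) - 1) = 4Δ²`, and every other record has score `0`.
-/
theorem integral_score_law_le {Δ : ℝ} (hΔ : 0 ≤ Δ) {i : Fin N} {p : Profile N A}
    (hp : G.utility i p = 1 / 2 + Δ) (n : ℕ) :
    ∫ τ, score Δ i p (τ n) ∂(alg.law G) ≤
      4 * Δ ^ 2 * (alg.law G).real {τ | τ n ∈ samplesOf p} := by
  have hS := measurableSet_samplesOf p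
  have hs := measurable_score (Δ := Δ) i p
  have hSn : MeasurableSet {τ : ℕ → Record N A | τ n ∈ samplesOf p} :=
    measurable_pi_apply (X := fun _ : ℕ => Record N A) n hS
  have hI : Measurable ((samplesOf p).indicator (1 : Record N A → ℝ)) := measurable_one.indicator hS
  have key := alg.integral_law_eval_nonpos G
    (g := fun x => score Δ i p x - 4 * Δ ^ 2 * (samplesOf p).indicator 1 x) (by fun_prop)
    (C := 2 * Δ + 4 * Δ ^ 2) (fun x => ?_) (fun q => ?_) (fun d => ?_) n
  · have h1 : Integrable (fun τ : ℕ → Record N A => score Δ i p (τ n)) (alg.law G) :=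
      .of_bound (Measurable.aestronglyMeasurable (by fun_prop)) (2 * Δ)
        (.of_forall fun τ => abs_score_le i p hΔ _)
    have h2 : (fun τ : ℕ → Record N A => (samplesOf p).indicator (1 : Record N A → ℝ) (τ n)) =
        {τ | τ n ∈ samplesOf p}.indicator 1 := by
      ext τ
      simp [Set.indicator]
    have h3 : Integrable (fun τ : ℕ → Record N A => (samplesOf p).indicator (1 : Record N A → ℝ) (τ n))
        (alg.law G) := by
      rw [h2]
      exact (integrable_const 1).indicator hSn
    rw [integral_sub h1 (h3.const_mul _), integral_const_mul, h2, integral_indicator_one hSn] at key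
    linarith
  · refine (abs_sub _ _).trans (add_le_add (abs_score_le i p hΔ x) ?_)
    rw [abs_mul, abs_of_nonneg (by positivity : 0 ≤ 4 * Δ ^ 2)]
    refine mul_le_of_le_one_right (by positivity) ?_
    by_cases hx : x ∈ samplesOf p <;> simp [hx]
  · have := G.isProbabilityMeasure_feedback q
    by_cases hq : q = p
    · subst hq
      have hi : Integrable (fun U : Feedback N => (U i : ℝ)) (G.feedback q) :=
        .of_bound (Measurable.aestronglyMeasurable (by fun_prop)) 1 (.of_forall fun U => by
          rw [Real.norm_of_nonneg (U i).2.1]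
          exact (U i).2.2)
      have hm := G.integral_feedback i q
      simp only [inl_mem_samplesOf, Set.indicator_of_mem, score, Sum.elim_inl, if_true, Pi.one_apply]
      have e : ∀ U : Feedback N, 2 * Δ * (2 * (U i : ℝ) - 1) - 4 * Δ ^ 2 * 1 =
          4 * Δ * (U i : ℝ) - (2 * Δ + 4 * Δ ^ 2) := fun U => by ring
      simp only [e]
      rw [integral_sub (hi.const_mul _) (integrable_const _), integral_const_mul, hm, hp]
      simp
      linarith
    · simp [score, hq, samplesOf, Set.indicator]
  · simp [score, samplesOf, Set.indicator]

/-- If the feedback of `G'` differs from that of `G` only at the profile `p`, and there only by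
`Δ`, then an event that is likely on `G` but not on `G'` requires many samples of `p` on `G`. -/
theorem law_real_le_of_score {Δ : ℝ} (hΔ : 0 ≤ Δ) (hΔ' : Δ < 1 / 2) {i : Fin N} {p : Profile N A}
    (hp : G.utility i p = 1 / 2 + Δ)
    (h : ∀ (q : Profile N A) (f : Feedback N → ℝ≥0∞), Measurable f →
      ∫⁻ U, f U ∂(G'.feedback q) =
        ∫⁻ U, f U * ENNReal.ofReal (1 + score Δ i p (Sum.inl (q, U)))⁻¹ ∂(G.feedback q))
    (n : ℕ) {F : Set (ℕ → Record N A)} (hF : MeasurableSet F)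
    (hdep : DependsOn (· ∈ F) (Set.Iic n)) :
    (alg.law G).real F ≤
      4 * Δ ^ 2 * ∑ k ∈ range (n + 1), (alg.law G).real {τ | τ k ∈ samplesOf p} +
        2 * (alg.law G').real F := by
  have hs := measurable_score (Δ := Δ) i p
  have hpos : ∀ x : Record N A, 1 - 2 * Δ ≤ 1 + score Δ i p x := fun x => by
    linarith [neg_abs_le (score Δ i p x), abs_score_le i p hΔ x]
  -- `Λ` is the density of the law on `G'` with respect to the law on `G`, for the records up to
  -- time `n`.
  let Λ : (ℕ → Record N A) → ℝ := fun τ => ∏ k ∈ range (n + 1), (1 + score Δ i p (τ k))⁻¹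
  have hΛm : Measurable Λ := Finset.measurable_fun_prod _ fun k _ => by fun_prop
  have hΛ0 : ∀ τ, 0 ≤ Λ τ := fun τ => prod_nonneg fun k _ =>
    inv_nonneg.2 (by linarith [hpos (τ k)])
  have hΛb : ∀ τ, Λ τ ≤ ∏ k ∈ range (n + 1), (1 - 2 * Δ)⁻¹ := fun τ =>
    prod_le_prod (fun k _ => inv_nonneg.2 (by linarith [hpos (τ k)])) fun k _ =>
      inv_anti₀ (by linarith) (hpos (τ k))
  have hΛi : Integrable Λ (alg.law G) :=
    .of_bound hΛm.aestronglyMeasurable _ (.of_forall fun τ => by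
      rw [Real.norm_of_nonneg (hΛ0 τ)]
      exact hΛb τ)
  have hmeas : ∀ B : Set (ℕ → Record N A), MeasurableSet B → DependsOn (· ∈ B) (Set.Iic n) →
      (alg.law G').real B = ∫ τ, B.indicator Λ τ ∂(alg.law G) := by
    intro B hB hBd
    have e := alg.lintegral_law_eq_lintegral_mul_prod G G'
      (r := fun x => ENNReal.ofReal (1 + score Δ i p x)⁻¹) (by fun_prop) (by simp [score]) h n
      (F := B.indicator 1) (measurable_one.indicator hB) (fun τ τ' hτ => by
        have := hBd hτ
        simp only [eq_iff_iff] at this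
        by_cases hb : τ ∈ B
        · simp [hb, this.1 hb]
        · simp [hb, mt this.2 hb])
    rw [lintegral_indicator_one hB] at e
    rw [measureReal_def, e, integral_eq_lintegral_of_nonneg_ae
      (.of_forall fun τ => Set.indicator_nonneg (fun τ _ => hΛ0 τ) τ)
      (hΛm.indicator hB).aestronglyMeasurable]
    congr 1
    refine lintegral_congr fun τ => ?_
    by_cases hτ : τ ∈ B
    · simp only [hτ, Set.indicator_of_mem, Pi.one_apply, one_mul]
      rw [ENNReal.ofReal_prod_of_nonneg fun k _ => inv_nonneg.2 (by linarith [hpos (τ k)])]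
    · simp [hτ]
  have hF' := hmeas F hF hdep
  have hu := hmeas Set.univ .univ (fun _ _ _ => by simp)
  rw [probReal_univ, Set.indicator_univ] at hu
  have hexp : ∀ τ, Real.exp (-∑ k ∈ range (n + 1), score Δ i p (τ k)) ≤ Λ τ := by
    intro τ
    rw [← sum_neg_distrib, Real.exp_sum]
    refine prod_le_prod (fun k _ => (Real.exp_pos _).le) fun k _ => ?_
    rw [Real.exp_neg]
    refine inv_anti₀ (by linarith [hpos (τ k)]) ?_
    rw [add_comm]
    exact Real.add_one_le_exp _
  -- With `X` minus the total score, `exp X ≤ Λ`. Off `F`, use `X + 1 ≤ exp X`; on `F`, use `X + 2 ≤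
  -- exp (X + 1) ≤ 3Λ`. Since `Λ` has integral `1` and its integral over `F` is the probability on
  -- `G'`, integration gives the claim.
  have hpt : ∀ τ, F.indicator (fun _ => (1 : ℝ)) τ - ∑ k ∈ range (n + 1), score Δ i p (τ k) ≤
      Λ τ - 1 + 2 * F.indicator Λ τ := by
    intro τ
    have h1 := hexp τ
    set X := -∑ k ∈ range (n + 1), score Δ i p (τ k) with hX
    by_cases hτ : τ ∈ F
    · have h2 : X + 1 + 1 ≤ Real.exp 1 * Λ τ := calc
        X + 1 + 1 ≤ Real.exp (X + 1) := Real.add_one_le_exp _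
        _ = Real.exp 1 * Real.exp X := by rw [Real.exp_add, mul_comm]
        _ ≤ _ := by gcongr
      have h3 : Real.exp 1 * Λ τ ≤ 3 * Λ τ := by
        gcongr
        · exact hΛ0 τ
        · linarith [Real.exp_one_lt_d9]
      simp only [hτ, Set.indicator_of_mem]
      linarith
    · simp only [hτ, not_false_eq_true, Set.indicator_of_notMem]
      linarith [Real.add_one_le_exp X]
  have hsi : ∀ k, Integrable (fun τ : ℕ → Record N A => score Δ i p (τ k)) (alg.law G) := fun k =>
    .of_bound (Measurable.aestronglyMeasurable (by fun_prop)) (2 * Δ)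
        (.of_forall fun τ => abs_score_le i p hΔ _)
  have hsum : Integrable (fun τ : ℕ → Record N A => ∑ k ∈ range (n + 1), score Δ i p (τ k))
      (alg.law G) := integrable_finsetSum _ fun k _ => hsi k
  have hFi : Integrable (F.indicator fun _ => (1 : ℝ)) (alg.law G) :=
    (integrable_const 1).indicator hF
  have hΛ1 : Integrable (fun τ => Λ τ - 1) (alg.law G) := hΛi.sub (integrable_const 1)
  have hint := integral_mono (hFi.sub hsum) (hΛ1.add ((hΛi.indicator hF).const_mul 2)) hpt
  simp only [Pi.sub_apply, Pi.add_apply] at hint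
  rw [integral_sub hFi hsum, integral_add hΛ1
    ((hΛi.indicator hF).const_mul 2), integral_sub hΛi (integrable_const 1), integral_const_mul,
    integral_finsetSum _ fun k _ => hsi k, ← hF', ← hu, integral_indicator_const _ hF] at hint
  have hle : ∑ k ∈ range (n + 1), ∫ τ, score Δ i p (τ k) ∂(alg.law G) ≤
      4 * Δ ^ 2 * ∑ k ∈ range (n + 1), (alg.law G).real {τ | τ k ∈ samplesOf p} := by
    rw [mul_sum]
    exact sum_le_sum fun k _ => alg.integral_score_law_le G hΔ hp k
  simp at hint
  linarith

/-- The change of measure needs a finite horizon, so it is applied to the event of having answered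
`d` by time `n`, and then `n` tends to infinity. -/
theorem ofReal_le_tsum_law_samplesOf {Δ : ℝ} (hΔ : 0 < Δ) (hΔ' : Δ < 1 / 2) {i : Fin N}
    {p : Profile N A} (hp : G.utility i p = 1 / 2 + Δ)
    (h : ∀ (q : Profile N A) (f : Feedback N → ℝ≥0∞), Measurable f →
      ∫⁻ U, f U ∂(G'.feedback q) =
        ∫⁻ U, f U * ENNReal.ofReal (1 + score Δ i p (Sum.inl (q, U)))⁻¹ ∂(G.feedback q))
    (d : Bool) {s t : ℝ} (hs : s ≤ (alg.law G).real (answers N A d))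
    (ht : (alg.law G').real (answers N A d) ≤ t) :
    ENNReal.ofReal ((s - 2 * t) / (4 * Δ ^ 2)) ≤ ∑' k, alg.law G {τ | τ k ∈ samplesOf p} := by
  by_cases htop : ∑' k, alg.law G {τ | τ k ∈ samplesOf p} = ⊤
  · simp [htop]
  let F : ℕ → Set (ℕ → Record N A) := fun n => ⋃ k ∈ Set.Iic n, {τ | τ k = Sum.inr d}
  have hFm : ∀ n, MeasurableSet (F n) := fun n =>
    MeasurableSet.biUnion (Set.to_countable _) fun k _ => measurableSet_eq_inr d k
  have hFd : ∀ n, DependsOn (· ∈ F n) (Set.Iic n) := by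
    intro n τ τ' hτ
    simp only [F, Set.mem_iUnion, Set.mem_ofPred_eq, eq_iff_iff]
    exact exists_congr fun k => exists_congr fun hk => by rw [hτ k hk]
  have hFmono : Monotone F := fun m n hmn => Set.biUnion_mono (Set.Iic_subset_Iic.2 hmn) fun _ _ =>
    subset_rfl
  have hFU : ⋃ n, F n = answers N A d := by
    ext τ
    simp only [F, Set.mem_iUnion, answers, Set.mem_ofPred_eq]
    exact ⟨fun ⟨n, k, _, hk⟩ => ⟨k, hk⟩, fun ⟨n, hn⟩ => ⟨n, n, Set.mem_Iic.2 le_rfl, hn⟩⟩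
  have hbound : ∀ n, (alg.law G).real (F n) ≤
      4 * Δ ^ 2 * (∑' k, alg.law G {τ | τ k ∈ samplesOf p}).toReal + 2 * t := by
    intro n
    refine (alg.law_real_le_of_score G G' hΔ.le hΔ' hp h n (hFm n) (hFd n)).trans ?_
    have h1 : ∑ k ∈ range (n + 1), (alg.law G).real {τ | τ k ∈ samplesOf p} ≤
        (∑' k, alg.law G {τ | τ k ∈ samplesOf p}).toReal := by
      simp only [measureReal_def]
      rw [← ENNReal.toReal_sum fun k _ => measure_ne_top _ _]
      exact ENNReal.toReal_mono htop (ENNReal.sum_le_tsum _)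
    have h2 : (alg.law G').real (F n) ≤ t :=
      (measureReal_mono (hFU ▸ Set.subset_iUnion F n)).trans ht
    gcongr
  have hlim : Filter.Tendsto (fun n => (alg.law G).real (F n)) Filter.atTop
      (nhds ((alg.law G).real (answers N A d))) := by
    rw [← hFU]
    exact (ENNReal.tendsto_toReal (measure_ne_top _ _)).comp (tendsto_measure_iUnion_atTop hFmono)
  have hfin := hs.trans (le_of_tendsto' hlim hbound)
  refine ENNReal.ofReal_le_of_le_toReal ?_
  rw [div_le_iff₀ (by positivity)]
  linarith

/-- Each record is a sample of at most one profile. -/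
theorem sum_tsum_law_samplesOf_le (S : Finset (Profile N A)) :
    ∑ p ∈ S, ∑' k, alg.law G {τ | τ k ∈ samplesOf p} ≤ alg.expectedSamples G := by
  have hm : ∀ (p : Profile N A) (k : ℕ), MeasurableSet {τ : ℕ → Record N A | τ k ∈ samplesOf p} :=
    fun p k => measurable_pi_apply (X := fun _ : ℕ => Record N A) k (measurableSet_samplesOf p)
  have e : ∑ p ∈ S, ∑' k, alg.law G {τ | τ k ∈ samplesOf p} = ∫⁻ τ, ∑' k, ∑ p ∈ S,
      {τ : ℕ → Record N A | τ k ∈ samplesOf p}.indicator 1 τ ∂(alg.law G) := by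
    rw [lintegral_tsum fun k => (Finset.measurable_fun_sum _ fun p _ =>
      measurable_one.indicator (hm p k)).aemeasurable, ← Summable.tsum_finsetSum
      fun _ _ => ENNReal.summable]
    refine tsum_congr fun k => ?_
    rw [lintegral_finsetSum _ fun p _ => measurable_one.indicator (hm p k)]
    exact Finset.sum_congr rfl fun p _ => (lintegral_indicator_one (hm p k)).symm
  rw [e]
  refine lintegral_mono fun τ => ENNReal.tsum_le_tsum fun k => ?_
  rcases hk : τ k with ⟨q, U⟩ | d
  · have : ∀ p ∈ S, {τ : ℕ → Record N A | τ k ∈ samplesOf p}.indicator (1 : (ℕ → Record N A) → ℝ≥0∞) τ =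
        if q = p then 1 else 0 := fun p _ => by
      simp [Set.indicator, hk, samplesOf, eq_comm]
    rw [Finset.sum_congr rfl this, Finset.sum_ite_eq]
    simp only [Sum.isLeft_inl, if_true]
    split_ifs <;> simp
  · simp [Set.indicator, hk, samplesOf]

end Algorithm

/-! ### Iterated elimination -/

namespace NormalFormGame

theorem monotone_eliminatedBy {α : Type*} {D : Set α → Set α} (hD : Monotone D) :
    Monotone (eliminatedBy D) := by
  refine monotone_nat_of_le_succ fun l => ?_
  induction l with
  | zero => exact Set.empty_subset _
  | succ l ih => exact hD ih

theorem exists_eliminatedBy_succ_eq {α : Type*} [Finite α] {D : Set α → Set α} (hD : Monotone D) :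
    ∃ l, eliminatedBy D (l + 1) = eliminatedBy D l := by
  obtain ⟨l, hl⟩ := WellFoundedGT.monotone_chain_condition ⟨_, monotone_eliminatedBy hD⟩
  exact ⟨l, (hl (l + 1) l.le_succ).symm⟩

variable {N A : ℕ} (G : NormalFormGame N A)

theorem monotone_dominated (Δ : ℝ) : Monotone (G.dominated Δ) :=
  fun _ _ hE _ ⟨x, hx, h⟩ => ⟨x, hx, fun b hb => h b fun j hj hm => hb j hj (hE hm)⟩

theorem eliminationLength_dominated_ne_zero {Δ : ℝ}
    (h : (G.dominated Δ ∅).Nonempty) : eliminationLength (G.dominated Δ) ≠ 0 := by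
  intro h0
  -- The infimum of the empty set is also `0`; that case is excluded because the increasing sequence
  -- of eliminated sets stabilizes on a finite type.
  rcases Nat.sInf_eq_zero.1 h0 with h1 | h1
  · have h2 : G.dominated Δ ∅ = ∅ := h1
    exact h.ne_empty h2
  · obtain ⟨l, hl⟩ := exists_eliminatedBy_succ_eq (G.monotone_dominated Δ)
    exact (Set.eq_empty_iff_forall_notMem.1 h1) l hl

theorem mixedUtility_single (i : Fin N) (a : Fin A) (b : Profile N A) :
    G.mixedUtility i (Pi.single a 1) b = G.utility i (Function.update b i a) := by
  simp [mixedUtility, Pi.single_apply]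

/-- Such an action lies in every `E_l` with `l ≥ 1`, so it suffices that the elimination length is
nonzero. -/
theorem not_deltaRationalizable_of_forall_le {Δ : ℝ} {i : Fin N} {a a' : Fin A}
    (h : ∀ b : Profile N A, G.utility i (Function.update b i a) ≤
      G.utility i (Function.update b i a') - Δ) :
    ¬ G.DeltaRationalizable Δ i a := by
  have hE : ∀ E, (i, a) ∈ G.dominated Δ E := fun E =>
    ⟨Pi.single a' 1, single_mem_stdSimplex ℝ a', fun b _ => by
      rw [mixedUtility_single]
      exact h b⟩
  obtain ⟨l, hl⟩ := Nat.exists_eq_succ_of_ne_zero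
    (G.eliminationLength_dominated_ne_zero ⟨_, hE ∅⟩)
  rw [DeltaRationalizable, not_not, hl]
  exact hE _

/-- If no unilateral deviation from the profile `p` changes the utility of the deviating player,
then every action is rationalizable. -/
theorem rationalizable_of_forall_eq (p : Profile N A)
    (h : ∀ j c, G.utility j (Function.update p j c) = G.utility j p) (i : Fin N) (a : Fin A) :
    G.Rationalizable i a := by
  -- Against `p`, every mixed strategy earns exactly what each pure action earns, so strict
  -- dominance fails.
  have h0 : G.strictlyDominated ∅ = ∅ := by
    refine Set.eq_empty_of_forall_notMem ?_
    rintro ⟨j, c⟩ ⟨x, hx, hlt⟩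
    have := hlt p fun _ _ => Set.notMem_empty _
    simp only [mixedUtility, h, ← Finset.sum_mul, hx.2, one_mul, lt_irrefl] at this
  have hE : ∀ l, eliminatedBy G.strictlyDominated l = ∅ := by
    intro l
    induction l with
    | zero => rfl
    | succ l ih => rw [eliminatedBy, ih, h0]
  rw [Rationalizable, hE]
  exact Set.notMem_empty _

end NormalFormGame

/-! ### The hard games -/

/-- The payoff vector with value `u` for player `i` and `1/2` for everyone else. -/
noncomputable def payoffVector {N : ℕ} (i : Fin N) (u : unitInterval) : Feedback N :=
  Function.update (fun _ => ⟨1 / 2, by norm_num, by norm_num⟩) i u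

/-- The law of the payoffs when player `i` receives `1` with probability `x` and `0` otherwise,
while everyone else receives `1/2`. -/
noncomputable def bernoulliPayoff {N : ℕ} (i : Fin N) (x : ℝ) : Measure (Feedback N) :=
  ENNReal.ofReal x • Measure.dirac (payoffVector i 1) +
    ENNReal.ofReal (1 - x) • Measure.dirac (payoffVector i 0)

theorem lintegral_bernoulliPayoff {N : ℕ} (i : Fin N) (x : ℝ) (f : Feedback N → ℝ≥0∞) :
    ∫⁻ U, f U ∂(bernoulliPayoff i x) =
      ENNReal.ofReal x * f (payoffVector i 1) + ENNReal.ofReal (1 - x) * f (payoffVector i 0) := by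
  simp [bernoulliPayoff, lintegral_add_measure, lintegral_smul_measure]

theorem integral_bernoulliPayoff {N : ℕ} (i : Fin N) {x : ℝ} (hx : x ∈ Set.Icc (0 : ℝ) 1)
    (f : Feedback N → ℝ) :
    ∫ U, f U ∂(bernoulliPayoff i x) = x * f (payoffVector i 1) + (1 - x) * f (payoffVector i 0) := by
  have hi : ∀ V : Feedback N, Integrable f (Measure.dirac V) := fun V =>
    integrable_dirac (by simp)
  rw [bernoulliPayoff, integral_add_measure ((hi _).smul_measure ENNReal.ofReal_ne_top)
    ((hi _).smul_measure ENNReal.ofReal_ne_top), integral_smul_measure, integral_smul_measure,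
    integral_dirac, integral_dirac, ENNReal.toReal_ofReal hx.1,
    ENNReal.toReal_ofReal (sub_nonneg.2 hx.2), smul_eq_mul, smul_eq_mul]

theorem isProbabilityMeasure_bernoulliPayoff {N : ℕ} (i : Fin N) {x : ℝ}
    (hx : x ∈ Set.Icc (0 : ℝ) 1) : IsProbabilityMeasure (bernoulliPayoff i x) := by
  refine ⟨?_⟩
  have := lintegral_bernoulliPayoff i x 1
  simp only [Pi.one_apply, lintegral_one, mul_one] at this
  rw [this, ← ENNReal.ofReal_add hx.1 (sub_nonneg.2 hx.2)]
  simp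

/-- The game in which player `i` receives a Bernoulli payoff of mean `1/2 + Δ` at the profiles
in `S` and of mean `1/2` elsewhere, while everyone else always receives `1/2`. -/
noncomputable def hardGame {N A : ℕ} {Δ : ℝ} (hΔ : Δ ∈ Set.Icc (0 : ℝ) (1 / 2)) (i : Fin N)
    (S : Finset (Profile N A)) : BanditGame N A where
  utility j p := if j = i ∧ p ∈ S then 1 / 2 + Δ else 1 / 2
  utility_mem j p := by
    obtain ⟨h0, h1⟩ := hΔ
    split_ifs <;> constructor <;> linarith
  feedback p := bernoulliPayoff i (if p ∈ S then 1 / 2 + Δ else 1 / 2)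
  isProbabilityMeasure_feedback p := by
    obtain ⟨h0, h1⟩ := hΔ
    refine isProbabilityMeasure_bernoulliPayoff i ?_
    split_ifs <;> constructor <;> linarith
  integral_feedback j p := by
    obtain ⟨h0, h1⟩ := hΔ
    rw [integral_bernoulliPayoff i (by split_ifs <;> constructor <;> linarith)]
    by_cases hj : j = i
    · subst hj
      simp [payoffVector]
    · simp [payoffVector, hj]
      split_ifs <;> ring

section hardGame

variable {N A : ℕ} {Δ : ℝ} (hΔ : Δ ∈ Set.Icc (0 : ℝ) (1 / 2)) (i : Fin N)

theorem not_deltaRationalizable_hardGame {a a' : Fin A} (ha : a ≠ a') :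
    ¬ (hardGame hΔ i {p : Profile N A | p i = a'}).DeltaRationalizable Δ i a := by
  refine NormalFormGame.not_deltaRationalizable_of_forall_le _ (a' := a') fun b => ?_
  simp [hardGame, ha]

/-- At `p` player `i` now earns `1/2`, and her deviations leave the bonus set altogether; the other
players always earn `1/2`. -/
theorem rationalizable_hardGame_erase {p : Profile N A} (j : Fin N) (a : Fin A) :
    (hardGame hΔ i (({q | q i = p i} : Finset (Profile N A)).erase p)).Rationalizable j a := by
  refine NormalFormGame.rationalizable_of_forall_eq _ p (fun k c => ?_) j a
  by_cases hk : k = i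
  · subst hk
    by_cases hc : c = p k
    · simp [hc]
    · simp [hardGame, hc]
  · simp [hardGame, hk]

theorem lintegral_feedback_hardGame_erase (hΔ' : Δ < 1 / 2) {S : Finset (Profile N A)}
    {p : Profile N A} (hp : p ∈ S) (q : Profile N A) (f : Feedback N → ℝ≥0∞) :
    ∫⁻ U, f U ∂((hardGame hΔ i (S.erase p)).feedback q) =
      ∫⁻ U, f U * ENNReal.ofReal (1 + score Δ i p (Sum.inl (q, U)))⁻¹
        ∂((hardGame hΔ i S).feedback q) := by
  simp only [hardGame, lintegral_bernoulliPayoff]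
  by_cases hq : q = p
  · subst hq
    have h0 := hΔ.1
    -- The likelihood ratios at `p` for payoffs `1` and `0` are `1/(1 + 2Δ)` and `1/(1 - 2Δ)`,
    -- matching scores `2Δ` and `-2Δ`.
    have e1 : ENNReal.ofReal (1 / 2) =
        ENNReal.ofReal (1 / 2 + Δ) * ENNReal.ofReal (1 + 2 * Δ)⁻¹ := by
      rw [← ENNReal.ofReal_mul (by linarith)]
      congr 1
      field_simp
    have e2 : ENNReal.ofReal (1 - 1 / 2) =
        ENNReal.ofReal (1 - (1 / 2 + Δ)) * ENNReal.ofReal (1 + -(2 * Δ))⁻¹ := by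
      rw [← ENNReal.ofReal_mul (by linarith)]
      congr 1
      have : 1 + -(2 * Δ) ≠ 0 := by linarith
      field_simp
      ring
    have s1 : score Δ i q (Sum.inl (q, payoffVector i 1)) = 2 * Δ := by
      simp [score, payoffVector]
      ring
    have s0 : score Δ i q (Sum.inl (q, payoffVector i 0)) = -(2 * Δ) := by
      simp [score, payoffVector]
    simp only [mem_erase, ne_eq, not_true_eq_false, false_and, if_false, hp, if_true, s1, s0]
    rw [e1, e2]
    ring
  · simp [score, hq]

end hardGame

/-! ### Summing over the profiles -/

theorem card_filter_apply_eq {N A : ℕ} (i : Fin N) (a : Fin A) :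
    #{p : Profile N A | p i = a} = A ^ (N - 1) := by
  have := Fintype.card_filter_piFinset_const_eq_of_mem (univ : Finset (Fin A)) i (mem_univ a)
  simpa using this

theorem Algorithm.Decides.le_expectedSamples {N A : ℕ} {Δ : ℝ}
    (hΔ : Δ ∈ Set.Icc (0 : ℝ) (1 / 2)) (h0 : 0 < Δ) (h1 : Δ < 1 / 2) {i : Fin N} {a a' : Fin A}
    (ha : a ≠ a') {alg : Algorithm N A}
    (h : alg.Decides (Set.range fun y : Fin N × Finset (Profile N A) => hardGame hΔ y.1 y.2)
      i a Δ 0.9) :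
    ENNReal.ofReal (1 / 8 * (A : ℝ) ^ (N - 1) / Δ ^ 2) ≤
      alg.expectedSamples (hardGame hΔ i {p : Profile N A | p i = a'}) := by
  set S : Finset (Profile N A) := {p | p i = a'} with hS
  have hno := (h _ ⟨(i, S), rfl⟩).2 (not_deltaRationalizable_hardGame hΔ i ha)
  refine le_trans ?_ (alg.sum_tsum_law_samplesOf_le _ S)
  -- On the original game no has probability at least `0.9`; on the modified one yes does, so no has
  -- at most `0.1`. The resulting constant `0.7/4` exceeds `1/8`.
  have hp : ∀ p ∈ S, ENNReal.ofReal ((0.9 - 2 * 0.1) / (4 * Δ ^ 2)) ≤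
      ∑' k, alg.law (hardGame hΔ i S) {τ | τ k ∈ samplesOf p} := by
    intro p hp
    have hpi : p i = a' := by simpa [hS] using hp
    have hyes := (h _ ⟨(i, S.erase p), rfl⟩).1 (by
      rw [hS, ← hpi]
      exact rationalizable_hardGame_erase hΔ i i a)
    refine alg.ofReal_le_tsum_law_samplesOf _ (hardGame hΔ i (S.erase p)) h0 h1
      (by simp [hardGame, hp]) (fun q f _ => lintegral_feedback_hardGame_erase hΔ i h1 hp q f)
      false hno ?_
    dsimp only at hyes
    linarith [alg.law_real_answers_add_le (hardGame hΔ i (S.erase p))]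
  refine le_trans ?_ (Finset.sum_le_sum hp)
  rw [sum_const, card_filter_apply_eq, nsmul_eq_mul, ← ENNReal.ofReal_natCast,
    ← ENNReal.ofReal_mul (by positivity)]
  refine ENNReal.ofReal_le_ofReal ?_
  push_cast
  rw [mul_div_assoc', div_le_div_iff₀ (by positivity) (by positivity)]
  have : 0 ≤ (A : ℝ) ^ (N - 1) * Δ ^ 2 := by positivity
  nlinarith

end BanditGames

theorem mainTheorem5 :
    ∃ c : ℝ, 0 < c ∧
      ∀ (N A : ℕ) (Δ : ℝ), 1 ≤ N → 2 ≤ A → 0 < Δ → Δ < 0.1 →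
        ∃ 𝒢 : Set (BanditGames.BanditGame N A),
          ∀ (i : Fin N) (a : Fin A),
            ∃ G₀ ∈ 𝒢, ∀ alg : BanditGames.Algorithm N A,
              alg.Decides 𝒢 i a Δ 0.9 →
                ENNReal.ofReal (c * (A : ℝ) ^ (N - 1) / Δ ^ 2) ≤ alg.expectedSamples G₀ := by
  refine ⟨1 / 8, by norm_num, fun N A Δ _ hA h0 h1 => ?_⟩
  have hΔ : Δ ∈ Set.Icc (0 : ℝ) (1 / 2) := ⟨h0.le, by linarith⟩
  -- The class must serve every `i` and `a` at once, so it contains all bonus sets for all players.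
  refine ⟨Set.range fun y : Fin N × Finset (BanditGames.Profile N A) =>
    BanditGames.hardGame hΔ y.1 y.2, fun i a => ?_⟩
  have : Nontrivial (Fin A) := Fin.nontrivial_iff_two_le.2 hA
  obtain ⟨a', ha'⟩ := exists_ne a
  exact ⟨_, ⟨(i, _), rfl⟩, fun alg h => h.le_expectedSamples hΔ h0 (by linarith) ha'.symm⟩
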